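/- Let $k$ be a field, let $X$ be a scheme over $k$, and let $G$ be a finite group acting on $X$ by $k$-automorphisms. Suppose that the quotient $Y=X/G$ exists as a scheme, that is, there is a $G$-invariant morphism of schemes $\nu\colon X\to Y$ such that, topologically, $Y$ is the orbit space of $X$ with the quotient topology, and such that the comorphism $\mathcal O_Y\to\nu_*\mathcal O_X$ identifies $\mathcal O_Y$ with the subsheaf $(\nu_*\mathcal O_X)^G$ of $G$-invariant sections. Suppose in addition that $H^0(X,\mathcal O_X)=k$ (i.e. the structure map $k\to H^0(X,\mathcal O_X)$ is bijective), and that there is a $k$-rational point $x\in X$ that is fixed by $G$. Then the canonical map $H^1(Y,\mathcal O_Y)\to H^1(X,\mathcal O_X)$ induced by $\nu$ is injective. -/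

import Mathlib

open CategoryTheory AlgebraicGeometry Limits TopologicalSpace Opposite

universe u

noncomputable section

namespace SchemeCohomology

/-! ### Sheaf cohomology and its contravariant functoriality -/

/-- Abelian sheaves on a topological space. -/
abbrev AbSheaf (T : TopCat.{u}) : Type (u + 1) :=
  Sheaf (Opens.grothendieckTopology T) AddCommGrpCat.{u}

/-- The constant sheaf `ℤ` on a topological space. -/
abbrev constZ (T : TopCat.{u}) : AbSheaf T :=
  (constantSheaf (Opens.grothendieckTopology T) AddCommGrpCat.{u}).obj
    (AddCommGrpCat.of (ULift.{u} ℤ))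

/-- Sheaf cohomology `Hⁿ(T, F)`, Mathlib's `Sheaf.H`, i.e. `Extⁿ(ℤ, F)`. -/
abbrev H {T : TopCat.{u}} (F : AbSheaf T) (n : ℕ) : Type u := Sheaf.H.{u} F n

variable {T T' : TopCat.{u}} (f : T ⟶ T')

/-- The direct image functor `f_*` on abelian sheaves, `(f_* F)(U) = F(f⁻¹ U)`. -/
abbrev pushforwardAb : AbSheaf T ⥤ AbSheaf T' :=
  (Opens.map f).sheafPushforwardContinuous AddCommGrpCat.{u}
    (Opens.grothendieckTopology T') (Opens.grothendieckTopology T)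

/-- The inverse image functor `f⁻¹` on abelian sheaves, left adjoint to `f_*`. -/
abbrev pullbackAb : AbSheaf T' ⥤ AbSheaf T :=
  (Opens.map f).sheafPullback AddCommGrpCat.{u}
    (Opens.grothendieckTopology T') (Opens.grothendieckTopology T)

/-- The adjunction `f⁻¹ ⊣ f_*` on abelian sheaves. -/
abbrev pullbackAdj : pullbackAb f ⊣ pushforwardAb f :=
  (Opens.map f).sheafAdjunctionContinuous AddCommGrpCat.{u}
    (Opens.grothendieckTopology T') (Opens.grothendieckTopology T)

set_option synthInstance.maxHeartbeats 400000 in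
instance : PreservesFiniteLimits (pullbackAb f) :=
  Functor.sheafPullbackConstruction.preservesFiniteLimits _ _ _ _

instance : PreservesFiniteColimits (pullbackAb f) :=
  have := (pullbackAdj f).leftAdjoint_preservesColimits
  inferInstance

instance : (pullbackAb f).Additive := Functor.additive_of_preserves_binary_products _

/-- The canonical morphism `ℤ_T ⟶ f⁻¹ ℤ_{T'}`: the global section of `f⁻¹ ℤ_{T'}` pulled back
from the global section `1` of `ℤ_{T'}`. -/
def constZToPullback : constZ T ⟶ (pullbackAb f).obj (constZ T') :=
  ((constantSheafAdj (Opens.grothendieckTopology T) AddCommGrpCat.{u}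
      (isTerminalTop : IsTerminal (⊤ : Opens T))).homEquiv _ _).symm
    (((constantSheafAdj (Opens.grothendieckTopology T') AddCommGrpCat.{u}
        (isTerminalTop : IsTerminal (⊤ : Opens T'))).homEquiv _ _)
      ((pullbackAdj f).unit.app (constZ T')))

/-- The canonical map `Hⁿ(T', F) → Hⁿ(T, f⁻¹ F)`: apply the exact functor `f⁻¹` to an element
of `Extⁿ(ℤ, F)`, then compose with `ℤ_T ⟶ f⁻¹ ℤ_{T'}`. -/
def HPullback (F : AbSheaf T') (n : ℕ) : H F n →+ H ((pullbackAb f).obj F) n :=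
  ((Abelian.Ext.mk₀ (constZToPullback f)).precomp ((pullbackAb f).obj F) (zero_add n)).comp
    ((pullbackAb f).mapExtAddHom (constZ T') F n)

/-- The map `Hⁿ(T', F) → Hⁿ(T, F')` induced by a continuous map `f : T ⟶ T'` and a morphism of
sheaves `F ⟶ f_* F'`. -/
def HMap {F : AbSheaf T'} {F' : AbSheaf T}
    (φ : F ⟶ (pushforwardAb f).obj F') (n : ℕ) : H F n →+ H F' n :=
  (Sheaf.H.map (((pullbackAdj f).homEquiv F F').symm φ) n).comp (HPullback f F n)

/-- The structure sheaf `𝒪_X` of a scheme, as a sheaf of abelian groups. -/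
def structureSheafAb (X : Scheme.{u}) : AbSheaf X.toTopCat :=
  (sheafCompose (Opens.grothendieckTopology X.toTopCat)
    (forget₂ CommRingCat.{u} RingCat.{u} ⋙ forget₂ RingCat.{u} AddCommGrpCat.{u})).obj X.sheaf

/-- The comorphism `𝒪_Y ⟶ f_* 𝒪_X` of a morphism of schemes `f : X ⟶ Y`. -/
def comorphismAb {X Y : Scheme.{u}} (f : X ⟶ Y) :
    structureSheafAb Y ⟶
      (pushforwardAb f.base).obj (structureSheafAb X) :=
  ⟨Functor.whiskerRight f.c
    (forget₂ CommRingCat.{u} RingCat.{u} ⋙ forget₂ RingCat.{u} AddCommGrpCat.{u})⟩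

/-- The canonical map `Hⁿ(Y, 𝒪_Y) → Hⁿ(X, 𝒪_X)` of a morphism of schemes `f : X ⟶ Y`. -/
def pullbackH {X Y : Scheme.{u}} (f : X ⟶ Y) (n : ℕ) :
    H (structureSheafAb Y) n →+ H (structureSheafAb X) n :=
  HMap f.base (comorphismAb f) n

end SchemeCohomology

namespace SchemeAction

/-! ### Quotients of schemes by group actions -/

variable {S : Scheme.{u}} {X : Over S} {Y : Scheme.{u}} {G : Type*} [Group G]

lemma preimage_le (ρ : G →* Aut X) (ν : X.left ⟶ Y) (hν : ∀ g, (ρ g).hom.left ≫ ν = ν)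
    (g : G) (U : Y.Opens) : ν ⁻¹ᵁ U ≤ (ρ g).hom.left ⁻¹ᵁ (ν ⁻¹ᵁ U) := by
  rw [← Scheme.Hom.comp_preimage, hν g]

/-- `ν : X ⟶ Y` exhibits the scheme `Y` as the quotient `X/G` of `X` by the action `ρ`, formed in
the category of ringed spaces: topologically `Y` is the orbit space with the quotient topology,
and `𝒪_Y` is the subsheaf of `G`-invariants of `ν_* 𝒪_X`. -/
structure IsQuotient (ρ : G →* Aut X) (ν : X.left ⟶ Y) : Prop where
  /-- `ν` is `G`-invariant. -/
  comp_eq (g : G) : (ρ g).hom.left ≫ ν = ν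
  /-- `Y` carries the quotient topology (in particular, `ν` is surjective). -/
  isQuotientMap : Topology.IsQuotientMap ν
  /-- Points of the same fibre of `ν` lie in the same orbit. -/
  exists_of_eq (x x' : X.left) : ν x = ν x' → ∃ g : G, (ρ g).hom.left x = x'
  /-- `𝒪_Y ⟶ ν_* 𝒪_X` is injective on sections. -/
  app_injective (U : Y.Opens) : Function.Injective (ν.app U)
  /-- Every `G`-invariant section of `ν_* 𝒪_X` comes from `𝒪_Y`. -/
  exists_app_eq (U : Y.Opens) (s : Γ(X.left, ν ⁻¹ᵁ U)) :
    (∀ g : G, (ρ g).hom.left.appLE (ν ⁻¹ᵁ U) (ν ⁻¹ᵁ U) (preimage_le ρ ν comp_eq g U) s = s) →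
      ∃ t : Γ(Y, U), ν.app U t = s

/-- The structure map `k → H⁰(X, 𝒪_X)` of a `k`-scheme. -/
def constants {k : Type u} [CommRing k] (X : Over (Spec (CommRingCat.of k))) :
    k →+* Γ(X.left, ⊤) :=
  ((Scheme.ΓSpecIso (CommRingCat.of k)).inv ≫ X.hom.appTop).hom

end SchemeAction

end

/-! Factor the map as H¹(Y, 𝒪_Y) → H¹(Y, ν_*𝒪_X) → H¹(X, 𝒪_X). The second map is injective for any
continuous map, the low-degree part of Leray (`eq_zero_of_mapExactFunctor_comp_counit_eq_zero`). The
first is injective once Q = ν_*𝒪_X/𝒪_Y has no nonzero global section. Lift a section of Q locally to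
functions b_y on X whose differences on overlaps are invariant. For each g the functions g·b_y - b_y
glue to a global function, hence a constant, and it vanishes at the fixed point. So every b_y is
invariant, lies in 𝒪_Y, and the section of Q is zero (`appLE_eq_of_sub_mem_range`). -/

namespace CategoryTheory.Abelian.Ext

universe w v v' u₁ u₂

variable {C : Type u₁} [Category.{v} C] [Abelian C] [HasExt.{w} C]
variable {D : Type u₂} [Category.{v'} D] [Abelian D] [HasExt.{w} D]

/-- If there are no nonzero morphisms from `Z` to the cokernel of a monomorphism `φ`, then `φ`
induces an injection on `Ext¹(Z, -)`. -/
lemma eq_zero_of_comp_mk₀_eq_zero {Z F P : C} (φ : F ⟶ P) [Mono φ]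
    (h : ∀ q : Z ⟶ cokernel φ, q = 0) (α : Ext Z F 1)
    (hα : α.comp (mk₀ φ) (add_zero 1) = 0) : α = 0 := by
  have hS : (ShortComplex.mk φ (cokernel.π φ) (cokernel.condition φ)).ShortExact :=
    { exact := ShortComplex.exact_of_g_is_cokernel _ (cokernelIsCokernel φ) }
  obtain ⟨β, rfl⟩ := covariant_sequence_exact₁ Z hS α hα (zero_add 1)
  obtain ⟨β, rfl⟩ := (mk₀_bijective _ _).2 β
  rw [h β, mk₀_zero, zero_comp]

/-- For an adjunction `L ⊣ R` with `L` exact, the canonical map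
`Ext¹(Z, R F) → Ext¹(L Z, F)` is injective. -/
lemma eq_zero_of_mapExactFunctor_comp_counit_eq_zero {L : C ⥤ D} {R : D ⥤ C} (adj : L ⊣ R)
    [L.Additive] [PreservesFiniteLimits L] [PreservesFiniteColimits L] [EnoughInjectives D]
    {Z : C} {F : D} (α : Ext Z (R.obj F) 1)
    (hα : (α.mapExactFunctor L).comp (mk₀ (adj.counit.app F)) (add_zero 1) = 0) : α = 0 := by
  have := adj.rightAdjoint_preservesLimits
  have : R.Additive := Functor.additive_of_preserves_binary_products _
  let i := Injective.ι F
  have : Injective (R.obj (Injective.under F)) := Injective.injective_of_adjoint adj _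
  let S : ShortComplex C := ShortComplex.mk (R.map i) (cokernel.π (R.map i)) (cokernel.condition _)
  let S' : ShortComplex D := ShortComplex.mk i (cokernel.π i) (cokernel.condition _)
  have hS : S.ShortExact :=
    { exact := ShortComplex.exact_of_g_is_cokernel _ (cokernelIsCokernel _)
      mono_f := inferInstanceAs (Mono (R.map i))
      epi_g := inferInstanceAs (Epi (cokernel.π (R.map i))) }
  have hS' : S'.ShortExact :=
    { exact := ShortComplex.exact_of_g_is_cokernel _ (cokernelIsCokernel _)
      mono_f := inferInstanceAs (Mono i)
      epi_g := inferInstanceAs (Epi (cokernel.π i)) }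
  have hR : (S'.map R).Exact := hS'.exact.map_of_mono_of_preservesKernel R inferInstance inferInstance
  -- Left exactness of `R` embeds the cokernel of `R.map i` in `R` of the cokernel of `i`.
  let d : S.X₃ ⟶ R.obj S'.X₃ := cokernel.desc _ (R.map S'.g) (S'.map R).zero
  have : Mono d := (S'.map R).exact_iff_mono_cokernel_desc.1 hR
  have hd : S.g ≫ d = R.map S'.g := cokernel.π_desc _ _ _
  let d' : L.obj S.X₃ ⟶ S'.X₃ := (adj.homEquiv _ _).symm d
  have hd' : L.map S.g ≫ d' = adj.counit.app _ ≫ S'.g := by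
    rw [← adj.homEquiv_naturality_left_symm, hd, adj.homEquiv_counit, adj.counit_naturality]
  let f : S.map L ⟶ S' := ⟨adj.counit.app _, adj.counit.app _, d',
    (adj.counit.naturality _).symm, hd'.symm⟩
  have hf : (hS.extClass.mapExactFunctor L).comp (mk₀ (adj.counit.app F)) (add_zero 1) =
      (mk₀ d').comp hS'.extClass (zero_add 1) :=
    (congrArg (fun e ↦ e.comp (mk₀ (adj.counit.app F)) (add_zero 1))
      (mapExactFunctor_extClass L hS)).trans
      (ShortComplex.ShortExact.extClass_naturality (hS.map_of_exact L) hS' f)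
  -- `R` of an injective is injective, so `α` is the boundary of some `β`.
  obtain ⟨β, rfl⟩ := covariant_sequence_exact₁ Z hS α (eq_zero_of_injective _) (zero_add 1)
  obtain ⟨β, rfl⟩ := (mk₀_bijective _ _).2 β
  rw [mapExactFunctor_comp, comp_assoc _ _ _ (zero_add 1) (add_zero 1) (by rfl), hf,
    mapExactFunctor_mk₀, ← comp_assoc _ _ _ (zero_add 0) (zero_add 1) (by rfl), mk₀_comp_mk₀] at hα
  -- The transpose of this lift `m` turns out to lift `β`, so the boundary of `β` vanishes.
  obtain ⟨m, hm⟩ := covariant_sequence_exact₃ _ hS' _ (zero_add 1) hα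
  obtain ⟨m, rfl⟩ := (mk₀_bijective _ _).2 m
  rw [mk₀_comp_mk₀] at hm
  replace hm := (mk₀_bijective _ _).1 hm
  have key : adj.homEquiv _ _ m ≫ S.g = β := by
    rw [← cancel_mono d, Category.assoc, hd, ← adj.homEquiv_naturality_right, hm,
      adj.homEquiv_naturality_left, Equiv.apply_symm_apply]
  rw [← key, ← mk₀_comp_mk₀, comp_assoc _ _ _ (zero_add 0) (zero_add 1) (by rfl)]
  simp

end CategoryTheory.Abelian.Ext

/-! ### Injectivity on H¹ for a continuous map -/

namespace SchemeCohomology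

variable {T T' : TopCat.{u}} (f : T ⟶ T')

lemma homEquiv_constZToPullback_comp {F : AbSheaf T}
    (g : (pullbackAb f).obj (constZ T') ⟶ F) :
    ((constantSheafAdj (Opens.grothendieckTopology T) AddCommGrpCat.{u}
      (isTerminalTop : IsTerminal (⊤ : Opens T))).homEquiv _ _) (constZToPullback f ≫ g) =
    ((constantSheafAdj (Opens.grothendieckTopology T') AddCommGrpCat.{u}
        (isTerminalTop : IsTerminal (⊤ : Opens T'))).homEquiv _ ((pushforwardAb f).obj F))
      ((pullbackAdj f).homEquiv _ _ g) := by
  rw [Adjunction.homEquiv_unit (pullbackAdj f), Adjunction.homEquiv_naturality_right,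
    Adjunction.homEquiv_naturality_right]
  exact congrArg (· ≫ ((sheafSections (Opens.grothendieckTopology T) AddCommGrpCat.{u}).obj
    (op ⊤)).map g) (Equiv.apply_symm_apply _ _)

/-- Both sheaves corepresent global sections, since (f_*F)(T') = F(T). -/
instance : IsIso (constZToPullback f) := by
  rw [isIso_iff_coyoneda_map_bijective]
  intro F
  have h : (fun g ↦ constZToPullback f ≫ g) = (((pullbackAdj f).homEquiv _ _).trans
      (((constantSheafAdj (Opens.grothendieckTopology T') AddCommGrpCat.{u}
        (isTerminalTop : IsTerminal (⊤ : Opens T'))).homEquiv _ ((pushforwardAb f).obj F)).trans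
      ((constantSheafAdj (Opens.grothendieckTopology T) AddCommGrpCat.{u}
      (isTerminalTop : IsTerminal (⊤ : Opens T))).homEquiv _ F).symm)) := by
    ext1 g
    exact (Equiv.eq_symm_apply _).2 (homEquiv_constZToPullback_comp f g)
  rw [h]
  exact Equiv.bijective _

/-- If `φ : F ⟶ f_* F'` is a monomorphism whose cokernel has no nonzero global sections, then
`H¹(T', F) → H¹(T, F')` is injective. -/
theorem HMap_one_injective {F : AbSheaf T'} {F' : AbSheaf T}
    (φ : F ⟶ (pushforwardAb f).obj F') [Mono φ] (h : ∀ q : constZ T' ⟶ cokernel φ, q = 0) :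
    Function.Injective (HMap f φ 1) := by
  rw [injective_iff_map_eq_zero]
  intro α hα
  refine Abelian.Ext.eq_zero_of_comp_mk₀_eq_zero φ h α
    (Abelian.Ext.eq_zero_of_mapExactFunctor_comp_counit_eq_zero (pullbackAdj f) _ ?_)
  have : (Abelian.Ext.mk₀ (constZToPullback f)).comp ((α.mapExactFunctor (pullbackAb f)).comp
      (Abelian.Ext.mk₀ (((pullbackAdj f).homEquiv F F').symm φ)) (add_zero 1)) (zero_add 1) = 0 := by
    rw [← Abelian.Ext.comp_assoc _ _ _ (zero_add 1) (add_zero 1) (by rfl)]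
    exact hα
  have := congrArg (fun e ↦ (Abelian.Ext.mk₀ (inv (constZToPullback f))).comp e (zero_add 1)) this
  simp at this
  rw [Abelian.Ext.mapExactFunctor_comp, Abelian.Ext.mapExactFunctor_mk₀,
    Abelian.Ext.comp_assoc _ _ _ (add_zero 1) (add_zero 0) (by rfl), Abelian.Ext.mk₀_comp_mk₀]
  simpa [Adjunction.homEquiv_counit] using this

end SchemeCohomology

namespace SchemeCohomology

/-- The cokernel of a monomorphism `φ : F ⟶ P` of abelian sheaves has no nonzero global sections
if every family of local sections of `P` whose differences on overlaps lie in `F` consists of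
sections of `F`. -/
lemma constZ_hom_cokernel_eq_zero {T : TopCat.{u}} {F P : AbSheaf T} (φ : F ⟶ P) [Mono φ]
    (h : ∀ (U : T → Opens T) (_ : ∀ t, t ∈ U t) (b : ∀ t, P.obj.obj (op (U t))),
      (∀ s t, ∃ a : F.obj.obj (op (U s ⊓ U t)), φ.hom.app _ a =
        P.obj.map (homOfLE inf_le_left).op (b s) - P.obj.map (homOfLE inf_le_right).op (b t)) →
      ∀ t, ∃ a : F.obj.obj (op (U t)), φ.hom.app _ a = b t)
    (q : constZ T ⟶ cokernel φ) : q = 0 := by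
  have hS : (ShortComplex.mk φ (cokernel.π φ) (cokernel.condition φ)).Exact :=
    ShortComplex.exact_of_g_is_cokernel _ (cokernelIsCokernel φ)
  have hp := (TopCat.Presheaf.isLocallySurjective_iff _).1
    ((TopCat.Sheaf.isLocallySurjective_iff_epi (cokernel.π φ)).2
      (inferInstanceAs (Epi (cokernel.π φ))))
  let e := Sheaf.H.equiv₀ (cokernel φ) (isTerminalTop : IsTerminal (⊤ : Opens T))
  have hz : ∀ (U : (Opens T)ᵒᵖ) (a : F.obj.obj U),
      (cokernel.π φ).hom.app U (φ.hom.app U a) = 0 := fun U a ↦ by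
    have := congrArg (fun m ↦ m.hom.app U a) (cokernel.condition φ)
    exact this
  suffices h0 : e (Abelian.Ext.mk₀ q) = 0 by
    rw [EmbeddingLike.map_eq_zero_iff] at h0
    exact (Abelian.Ext.mk₀_eq_zero_iff q).1 h0
  generalize e (Abelian.Ext.mk₀ q) = s
  choose U hUle b hU using fun t : T ↦ hp ⊤ s t trivial
  choose b hb using b
  -- Two lifts of `s` have the same image in the cokernel, so left exactness of sections puts their
  -- difference in `F`.
  have hb' := h U hU b fun t t' ↦ by
    refine TopCat.Sheaf.sections_exact_of_left_exact hS ‹_› _ ?_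
    change (cokernel.π φ).hom.app _ _ = 0
    rw [map_sub, NatTrans.naturality_apply, NatTrans.naturality_apply, hb, hb, sub_eq_zero]
    change (cokernel φ).obj.map _ ((cokernel φ).obj.map _ s) =
      (cokernel φ).obj.map _ ((cokernel φ).obj.map _ s)
    rw [← ConcreteCategory.comp_apply, ← Functor.map_comp, ← ConcreteCategory.comp_apply,
      ← Functor.map_comp]
    rfl
  refine TopCat.Sheaf.eq_of_locally_eq' (cokernel φ) U ⊤ (fun t ↦ homOfLE le_top)
    (fun t _ ↦ Opens.mem_iSup.2 ⟨t, hU t⟩) s 0 fun t ↦ ?_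
  obtain ⟨a, ha⟩ := hb' t
  exact (hb t).symm.trans ((congrArg _ ha.symm).trans ((hz _ a).trans (map_zero _).symm))

end SchemeCohomology

/-! ### Invariance of local lifts on the quotient -/

namespace SchemeAction

variable {k : Type u} [Field k] {X : Over (Spec (CommRingCat.of k))}
    {G : Type*} [Group G] {ρ : G →* Aut X} {Y : Scheme.{u}} {ν : X.left ⟶ Y}

/-- A constant function that vanishes on a neighbourhood of a rational point is zero. -/
lemma constants_eq_zero (x : Over.mk (𝟙 (Spec (CommRingCat.of k))) ⟶ X) (c : k)
    (U : X.left.Opens) (h : Nonempty (x.left ⁻¹ᵁ U : Scheme.Opens _))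
    (hc : x.left.appLE U (x.left ⁻¹ᵁ U) le_rfl
      (X.left.presheaf.map (homOfLE le_top).op (constants X c)) = 0) : c = 0 := by
  by_contra h0
  let V : (Over.mk (𝟙 (Spec (CommRingCat.of k)))).left.Opens := x.left ⁻¹ᵁ U
  let r : k →+* Γ((Over.mk (𝟙 (Spec (CommRingCat.of k)))).left, V) :=
    ((x.left.appLE U V le_rfl).hom.comp (X.left.presheaf.map (homOfLE le_top).op).hom).comp
      (constants X)
  -- This makes the target of `r` a nontrivial ring, so `r` is injective on the field `k`.
  have : Nonempty V := h
  exact h0 ((map_eq_zero r).1 hc)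

lemma IsQuotient.appLE_app (hν : IsQuotient ρ ν) (g : G) (U : Y.Opens) (s : Γ(Y, U)) :
    (ρ g).hom.left.appLE _ _ (preimage_le ρ ν hν.comp_eq g U) (ν.app U s) = ν.app U s := by
  have aux (a : X.left ⟶ X.left) (ha : a ≫ ν = ν) (e : ν ⁻¹ᵁ U ≤ a ⁻¹ᵁ (ν ⁻¹ᵁ U)) :
      a.appLE _ _ e (ν.app U s) = ν.app U s := by
    rw [← CommRingCat.comp_apply, Scheme.Hom.app_eq_appLE, Scheme.Hom.appLE_comp_appLE]
    congr 3
  exact aux _ (hν.comp_eq g) _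

lemma IsQuotient.appLE_map (hν : IsQuotient ρ ν) (g : G) {U V : Y.Opens} (h : U ≤ V)
    (s : Γ(X.left, ν ⁻¹ᵁ V)) :
    (ρ g).hom.left.appLE _ _ (preimage_le ρ ν hν.comp_eq g U)
        (X.left.presheaf.map (homOfLE (ν.preimage_mono h)).op s) =
      X.left.presheaf.map (homOfLE (ν.preimage_mono h)).op
        ((ρ g).hom.left.appLE _ _ (preimage_le ρ ν hν.comp_eq g V) s) := by
  rw [← CommRingCat.comp_apply, ← CommRingCat.comp_apply, Scheme.Hom.map_appLE,
    Scheme.Hom.appLE_map]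

/-- Sections over an open cover of the quotient that differ by invariant sections on overlaps
are themselves invariant. -/
lemma IsQuotient.appLE_eq_of_sub_mem_range (hν : IsQuotient ρ ν)
    (hX : Function.Surjective (constants X))
    (x : Over.mk (𝟙 (Spec (CommRingCat.of k))) ⟶ X) (hx : ∀ g : G, x ≫ (ρ g).hom = x)
    (U : Y → Y.Opens) (hU : ∀ y, y ∈ U y) (b : ∀ y, Γ(X.left, ν ⁻¹ᵁ U y))
    (hb : ∀ s t, ∃ a : Γ(Y, U s ⊓ U t), ν.app _ a =
      X.left.presheaf.map (homOfLE (ν.preimage_mono inf_le_left)).op (b s) -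
      X.left.presheaf.map (homOfLE (ν.preimage_mono inf_le_right)).op (b t))
    (g : G) (y : Y) :
    (ρ g).hom.left.appLE _ _ (preimage_le ρ ν hν.comp_eq g (U y)) (b y) = b y := by
  let d (y : Y) : Γ(X.left, ν ⁻¹ᵁ U y) :=
    (ρ g).hom.left.appLE _ _ (preimage_le ρ ν hν.comp_eq g (U y)) (b y) - b y
  have hd : TopCat.Presheaf.IsCompatible X.left.sheaf.1 (fun y ↦ ν ⁻¹ᵁ U y) d := by
    intro s t
    obtain ⟨a, ha⟩ := hb s t
    have h := hν.appLE_app g _ a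
    rw [ha, map_sub, hν.appLE_map g inf_le_left, hν.appLE_map g inf_le_right, 
      sub_eq_sub_iff_sub_eq_sub, ← map_sub,
      ← map_sub] at h
    exact h
  obtain ⟨c, hc, -⟩ := X.left.sheaf.existsUnique_gluing' (fun y ↦ ν ⁻¹ᵁ U y) ⊤
    (fun y ↦ homOfLE le_top) (fun z _ ↦ Opens.mem_iSup.2 ⟨ν z, hU (ν z)⟩) d hd
  obtain ⟨c, rfl⟩ := hX c
  have hc' (y : Y) : X.left.presheaf.map (homOfLE le_top).op (constants X c) = d y := hc y
  let z : Spec (CommRingCat.of k) := Classical.arbitrary _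
  have h0 : c = 0 := by
    refine constants_eq_zero x c (ν ⁻¹ᵁ U (ν (x.left z))) ⟨⟨z, hU _⟩⟩ ?_
    -- Since g fixes x, g·b and b have the same pullback along x.
    rw [hc', map_sub, sub_eq_zero, ← CommRingCat.comp_apply, Scheme.Hom.appLE_comp_appLE]
    congr 3
    exact congrArg CommaMorphism.left (hx g)
  exact sub_eq_zero.1 ((hc' y).symm.trans (by rw [h0, map_zero, map_zero]))

lemma IsQuotient.pullbackH_one_injective (hν : IsQuotient ρ ν)
    (hX : Function.Surjective (constants X))
    (x : Over.mk (𝟙 (Spec (CommRingCat.of k))) ⟶ X) (hx : ∀ g : G, x ≫ (ρ g).hom = x) :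
    Function.Injective (SchemeCohomology.pullbackH ν 1) := by
  have : Mono (SchemeCohomology.comorphismAb ν) := by
    have (U : (Opens Y)ᵒᵖ) : Mono ((SchemeCohomology.comorphismAb ν).hom.app U) :=
      (AddCommGrpCat.mono_iff_injective _).2 (hν.app_injective U.unop)
    have := NatTrans.mono_of_mono_app (SchemeCohomology.comorphismAb ν).hom
    exact (sheafToPresheaf _ _).mono_of_mono_map this
  refine SchemeCohomology.HMap_one_injective _ _
    (SchemeCohomology.constZ_hom_cokernel_eq_zero _ fun U hU b hb y ↦ ?_)
  exact hν.exists_app_eq (U y) (b y) fun g ↦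
    hν.appLE_eq_of_sub_mem_range hX x hx U hU b hb g y

end SchemeAction

theorem mainTheorem12 {k : Type u} [Field k] {X : Over (Spec (CommRingCat.of k))}
    {G : Type*} [Group G] [Finite G] (ρ : G →* Aut X)
    {Y : Scheme.{u}} (ν : X.left ⟶ Y) (hν : SchemeAction.IsQuotient ρ ν)
    (hX : Function.Bijective (SchemeAction.constants X))
    (x : Over.mk (𝟙 (Spec (CommRingCat.of k))) ⟶ X) (hx : ∀ g : G, x ≫ (ρ g).hom = x) :
    Function.Injective (SchemeCohomology.pullbackH ν 1) :=
  hν.pullbackH_one_injective hX.surjective x hx
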